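/- Let $n\ge 1$. A permutation is identified with its one-line notation $a_1a_2\cdots a_n$, and $\mathrm{Av}_n(123,132)$ denotes the set of permutations of $\{1,\dots,n\}$ that contain no subsequence in the same relative order as $123$ or $132$. Let $$P=P_n(123,132):=\operatorname{conv}\{(a_1,\dots,a_n)\in\mathbb{R}^n \mid a_1\cdots a_n\in \mathrm{Av}_n(123,132)\}.$$ Then: 1. $P$ is a combinatorial cube: its face lattice is isomorphic to that of the $(n-1)$-dimensional cube $[0,1]^{n-1}$. 2. If $n\ge 2$, the Ehrhart polynomial of $P$, that is, the polynomial $\mathrm{ehr}_P$ with $\mathrm{ehr}_P(m)=|mP\cap\mathbb{Z}^n|$ for all integers $m\ge 0$, is $$\mathrm{ehr}_P(m)=\frac{m+1}{(n-1)!}\prod_{j=2}^{n-1}(nm+j).$$ 3. The affine map $f(a_1,\dots,a_n)=(a_1,\dots,a_{n-1})-(n-1,n-2,\dots,1)$ restricts to a bijection from $P$ onto the Pitman–Stanley polytope $$PS_{n-1}(1,\dots,1)=\Big\{x\in\mathbb{R}^{n-1}\ \Big|\ x_i\ge 0 \text{ and } \sum_{i=1}^j x_i\le j \text{ for all } 1\le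 j\le n-1\Big\},$$ and to a bijection from $(\operatorname{aff}P)\cap\mathbb{Z}^n$ onto $\mathbb{Z}^{n-1}$. 4. The normalized volume of $P$, that is, $(\dim P)!$ times its volume relative to the lattice $(\operatorname{aff}P)\cap\mathbb{Z}^n$, is $n^{n-2}$. 5. The number of points of $\mathbb{Z}^n$ in $P$ is the Catalan number $C_n=\frac{1}{n+1}\binom{2n}{n}$. -/

import Mathlib

open scoped Pointwise

noncomputable section

/-- The permutation `σ`, written in one-line notation, contains the pattern `π`: some subsequence
of `σ` is in the same relative order as `π`. -/
def ContainsPattern {n k : ℕ} (σ : Equiv.Perm (Fin n)) (π : Equiv.Perm (Fin k)) : Prop :=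
  ∃ f : Fin k ↪o Fin n, ∀ i j : Fin k, σ (f i) < σ (f j) ↔ π i < π j

/-- `Av_n(Π)`: the permutations of length `n` that contain no pattern in `Π`. -/
def Av (n : ℕ) (Pats : Set (Σ k : ℕ, Equiv.Perm (Fin k))) : Set (Equiv.Perm (Fin n)) :=
  {σ | ∀ π ∈ Pats, ¬ ContainsPattern σ π.2}

/-- The pattern `123`. -/
def pattern123 : Σ k : ℕ, Equiv.Perm (Fin k) := ⟨3, 1⟩

/-- The pattern `132` (the entries are counted from `0` here, so that this is `0, 2, 1`). -/
def pattern132 : Σ k : ℕ, Equiv.Perm (Fin k) := ⟨3, Equiv.swap 1 2⟩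

/-- The point `(a₁, …, aₙ)` whose coordinates are the one-line notation of `σ`. -/
def permPoint {n : ℕ} (σ : Equiv.Perm (Fin n)) : Fin n → ℝ := fun i => ((σ i : ℕ) : ℝ) + 1

/-- The `Π`-avoiding permutohedron `P_n(Π)`. -/
def avoidingPermutohedron (n : ℕ) (Pats : Set (Σ k : ℕ, Equiv.Perm (Fin k))) :
    Set (Fin n → ℝ) :=
  convexHull ℝ (permPoint '' Av n Pats)

/-- The Pitman–Stanley polytope `PS_d(c)`. -/
def pitmanStanley (d : ℕ) (c : Fin d → ℝ) : Set (Fin d → ℝ) :=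
  {x | (∀ i, 0 ≤ x i) ∧ ∀ j, ∑ i ∈ Finset.Iic j, x i ≤ ∑ i ∈ Finset.Iic j, c i}

/-- The face lattice of a polytope: its faces (`∅`, the polytope itself, and the sets of maximizers
of linear functionals), ordered by inclusion. -/
abbrev FaceLattice {n : ℕ} (P : Set (Fin n → ℝ)) : Type :=
  {F : Set (Fin n → ℝ) // IsExposed ℝ P F}

/-- Two polytopes are combinatorially equivalent if their face lattices are isomorphic. -/
def CombinatoriallyEquivalent {n d : ℕ} (P : Set (Fin n → ℝ)) (Q : Set (Fin d → ℝ)) : Prop :=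
  Nonempty (FaceLattice P ≃o FaceLattice Q)

/-- The unit cube `[0,1]^d`. -/
def unitCube (d : ℕ) : Set (Fin d → ℝ) := Set.Icc 0 1

/-- The lattice `ℤⁿ` in `ℝⁿ`. -/
def integerLattice (n : ℕ) : Submodule ℤ (Fin n → ℝ) where
  carrier := {x | ∀ i, ∃ z : ℤ, x i = (z : ℝ)}
  zero_mem' := fun _ => ⟨0, by simp⟩
  add_mem' := by
    intro x y hx hy i
    obtain ⟨a, ha⟩ := hx i
    obtain ⟨b, hb⟩ := hy i
    exact ⟨a + b, by simp [ha, hb]⟩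
  smul_mem' := by
    intro c x hx i
    obtain ⟨a, ha⟩ := hx i
    exact ⟨c * a, by simp [ha]⟩

/-- The set of lattice points of `P`. -/
def latticePoints {n : ℕ} (P : Set (Fin n → ℝ)) : Set (Fin n → ℝ) := P ∩ integerLattice n

/-- `p` is the Ehrhart polynomial of `P`: for every `m`, the dilate `mP` has exactly `p(m)` lattice
points. -/
def IsEhrhartPolynomial {n : ℕ} (P : Set (Fin n → ℝ)) (p : Polynomial ℚ) : Prop :=
  ∀ m : ℕ, (latticePoints ((m : ℝ) • P)).Finite ∧
    ((latticePoints ((m : ℝ) • P)).ncard : ℚ) = p.eval (m : ℚ)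

/-- The linear space parallel to the affine span of `P`. -/
abbrev parallelSpace {n : ℕ} (P : Set (Fin n → ℝ)) : Submodule ℝ (Fin n → ℝ) :=
  (affineSpan ℝ P).direction

/-- The integer points of the linear space parallel to `aff P`. If `aff P` contains an integer
point, this is a translate of `aff P ∩ ℤⁿ`. -/
def parallelLattice {n : ℕ} (P : Set (Fin n → ℝ)) : Submodule ℤ (parallelSpace P) :=
  (integerLattice n).comap ((parallelSpace P).subtype.restrictScalars ℤ)

/-- The volume of a lattice polytope `P` relative to the lattice `aff P ∩ ℤⁿ`: a translation
invariant measure of `P` inside `aff P`, divided by the measure of a fundamental domain of the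
lattice. The quotient depends neither on the normalization of the measure nor on the base point of
`P` by which `P` is moved into the parallel linear space. -/
def relativeVolume {n : ℕ} (P : Set (Fin n → ℝ)) : ℝ :=
  open Classical in
  if h : P.Nonempty then
    (MeasureTheory.Measure.addHaar : MeasureTheory.Measure (parallelSpace P)).real
        {v | h.some + (v : Fin n → ℝ) ∈ P} /
      ZLattice.covolume (parallelLattice P) MeasureTheory.Measure.addHaar
  else 0

/-- The normalized volume `Vol P = (dim P)! vol(P)`. -/
def normalizedVolume {n : ℕ} (P : Set (Fin n → ℝ)) : ℝ :=
  ((Module.finrank ℝ (parallelSpace P)).factorial : ℝ) * relativeVolume P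

/-- The affine map `(a₁, …, aₙ) ↦ (a₁, …, aₙ₋₁) - (n-1, n-2, …, 1)`. -/
def projShift (n : ℕ) (a : Fin n → ℝ) : Fin (n - 1) → ℝ :=
  fun i => a (Fin.castLE (Nat.sub_le n 1) i) - ((n : ℝ) - ((i : ℕ) + 1))

end

/-!
Write `n = d + 1`. In a permutation that avoids 123 and 132 every entry is followed by at most one
larger entry, so each entry is the largest or the second largest of those that are left. Recording
the positions before the last where the largest one is taken identifies these permutations with the
subsets `S` of `Fin d` (`avPerm`). After the projection that forgets the last coordinate and
subtracts `(d, …, 1)`, the permutation of `S` becomes the point `psVertex S` whose partial sums are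
`lastBefore S`. These points generate the Pitman–Stanley polytope `PS_d(1, …, 1)`
(`pitmanStanley_eq_convexHull`): by induction on the support, the last nonzero coordinate of a point
interpolates between its smallest and its largest possible value, and both are attained by affine
maps that preserve the set of the `psVertex S`. Hence the permutohedron is the image of
`PS_d(1, …, 1)` under the affine embedding `liftMap d 1` (`avoidingPermutohedron_eq_image`), which
matches the lattices, and all assertions become assertions about `PS_d(1, …, 1)`.

* Faces. The inequalities `0 ≤ x j` and `x 0 + ⋯ + x j ≤ j + 1` come in `d` pairs, and `psVertex S`
  is tight for exactly one inequality of each pair. `IsCubical` isolates this incidence pattern, and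
  `IsCubical.nonempty_orderIso` shows that it determines the face lattice: a face is the convex hull
  of its vertices, and the vertex sets of nonempty faces are the intervals of the Boolean lattice.
  The unit cube is cubical as well.
* Lattice points. The lattice points of the `m`-th dilate are sequences of natural numbers with
  bounded partial sums. Splitting off the first term gives a recursion over the number of terms and
  the first bound, which the product formula `card_boundedSeqs` satisfies by telescoping. At `m = 1`
  the formula gives the Catalan numbers.
* Volume. In the coordinates of the first `d` entries the relative volume is the Lebesgue measure of
  `PS_d(1, …, 1)` (`relativeVolume_image_liftMap`), which is the limit of the scaled lattice point
  counts, that is, the leading coefficient of the Ehrhart polynomial.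
-/

/-! ### Polytopes with the vertex-facet incidences of a cube -/

/-- `Q` is a polytope whose vertices `V S` are indexed by the subsets `S` of `Fin d` and whose
facet inequalities inside the affine subspace `L` come in `d` pairs `0 ≤ f j`, `0 ≤ g j`, with the
incidences of the `d`-cube: `V S` lies on the facet `f j = 0` if `j ∉ S`, and on the facet
`g j = 0` if `j ∈ S`. -/
structure IsCubical {n d : ℕ} (Q : Set (Fin n → ℝ)) (V : Finset (Fin d) → Fin n → ℝ)
    (L : AffineSubspace ℝ (Fin n → ℝ)) (f g : Fin d → (Fin n → ℝ) →ᵃ[ℝ] ℝ) : Prop where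
  eq_convexHull : Q = convexHull ℝ (Set.range V)
  mem_iff : ∀ x, x ∈ Q ↔ x ∈ L ∧ ∀ j, 0 ≤ f j x ∧ 0 ≤ g j x
  f_eq_zero : ∀ j S, f j (V S) = 0 ↔ j ∉ S
  g_eq_zero : ∀ j S, g j (V S) = 0 ↔ j ∈ S

/-- The face lattice of the `d`-cube, a face being encoded by its vertices: the intervals in the
Boolean lattice of subsets of `Fin d`, together with `∅`. -/
abbrev CubeFaces (d : ℕ) : Type :=
  {𝒮 : Set (Finset (Fin d)) // 𝒮 = ∅ ∨ ∃ A B, 𝒮 = Set.Icc A B}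

/-- A point of an exposed face of a convex hull is a convex combination of generators that lie in
that face. -/
lemma IsExposed.subset_convexHull_inter {n : ℕ} {V F : Set (Fin n → ℝ)}
    (hF : IsExposed ℝ (convexHull ℝ V) F) : F ⊆ convexHull ℝ (V ∩ F) := by
  intro x hx
  obtain ⟨l, hl⟩ := hF ⟨x, hx⟩
  have hx' := hx
  rw [hl] at hx'
  obtain ⟨hxQ, hmax⟩ := hx'
  have hlow : ∀ v ∈ V \ F, l v < l x := by
    intro v hv
    have hvQ := subset_convexHull ℝ V hv.1
    refine lt_of_le_of_ne (hmax v hvQ) fun h => hv.2 ?_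
    rw [hl]
    exact ⟨hvQ, fun y hy => h ▸ hmax y hy⟩
  have hconv : Convex ℝ {y : Fin n → ℝ | l y < l x} :=
    convex_halfSpace_lt l.toLinearMap.isLinear _
  have hsub : convexHull ℝ (V \ F) ⊆ {y | l y < l x} := convexHull_min hlow hconv
  rcases (V \ F).eq_empty_or_nonempty with h2 | h2
  · rwa [Set.inter_eq_left.2 (Set.sdiff_eq_empty.1 h2)]
  rcases (V ∩ F).eq_empty_or_nonempty with h1 | h1
  · have : V \ F = V := by
      rw [← Set.sdiff_self_inter, h1, Set.sdiff_empty]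
    rw [this] at hsub
    exact absurd (hsub hxQ) (lt_irrefl (l x))
  rw [← Set.inter_union_sdiff V F, convexHull_union h1 h2, mem_convexJoin] at hxQ
  obtain ⟨y, hy, z, hz, a, b, ha, hb, hab, rfl⟩ := hxQ
  have hyQ : y ∈ convexHull ℝ V := convexHull_mono Set.inter_subset_left hy
  have h3 := hmax y hyQ
  have h4 : l z < l (a • y + b • z) := hsub hz
  -- the functional is smaller at `z`, so the weight of `z` has to vanish
  have hb0 : b = 0 := by
    by_contra hne
    have hbpos : 0 < b := lt_of_le_of_ne hb (Ne.symm hne)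
    have h5 : l (a • y + b • z) = a * l y + b * l z := by simp
    have h6 : a * l y ≤ a * l (a • y + b • z) := mul_le_mul_of_nonneg_left h3 ha
    have h7 : b * l z < b * l (a • y + b • z) := mul_lt_mul_of_pos_left h4 hbpos
    have h8 : a * l (a • y + b • z) + b * l (a • y + b • z) = l (a • y + b • z) := by
      rw [← add_mul, hab, one_mul]
    linarith
  subst hb0
  have ha1 : a = 1 := by linarith
  subst ha1
  simpa using hy

lemma AffineMap.finset_sum_apply {ι E : Type*} [AddCommGroup E] [Module ℝ E] (s : Finset ι)
    (f : ι → E →ᵃ[ℝ] ℝ) (x : E) : (∑ i ∈ s, f i) x = ∑ i ∈ s, f i x := by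
  classical
  induction s using Finset.induction_on with
  | empty => simp
  | insert a s ha ih => simp [Finset.sum_insert ha, ih]

namespace IsCubical

variable {n d : ℕ} {Q : Set (Fin n → ℝ)} {V : Finset (Fin d) → Fin n → ℝ}
  {L : AffineSubspace ℝ (Fin n → ℝ)} {f g : Fin d → (Fin n → ℝ) →ᵃ[ℝ] ℝ}

lemma convex (h : IsCubical Q V L f g) : Convex ℝ Q := by
  rw [h.eq_convexHull]
  exact convex_convexHull ℝ _

lemma vertex_mem (h : IsCubical Q V L f g) (S : Finset (Fin d)) : V S ∈ Q := by
  rw [h.eq_convexHull]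
  exact subset_convexHull ℝ _ ⟨S, rfl⟩

/-- An affine function that is nonnegative at `m`, and that vanishes at `u` if it vanishes at `m`,
stays nonnegative for a short while on the ray from `u` through `m` beyond `m`. -/
lemma _root_.AffineMap.eventually_nonneg_lineMap {E : Type*} [AddCommGroup E] [Module ℝ E]
    (φ : E →ᵃ[ℝ] ℝ) {u m : E} (hm : 0 ≤ φ m) (h0 : φ m = 0 → φ u = 0) :
    ∀ᶠ ε in nhdsWithin (0 : ℝ) (Set.Ioi 0), 0 ≤ φ (AffineMap.lineMap u m (1 + ε)) := by
  have hval : ∀ ε : ℝ, φ (AffineMap.lineMap u m (1 + ε)) = φ m + ε * (φ m - φ u) := by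
    intro ε
    rw [AffineMap.apply_lineMap, AffineMap.lineMap_apply_ring']
    ring
  simp only [hval]
  rcases hm.eq_or_lt with h | h
  · rw [← h, h0 h.symm]
    simp
  · have hc : Continuous fun ε : ℝ => φ m + ε * (φ m - φ u) := by fun_prop
    have : ∀ᶠ ε in nhds (0 : ℝ), 0 < φ m + ε * (φ m - φ u) :=
      hc.continuousAt.eventually (lt_mem_nhds (by simpa using h))
    exact (this.filter_mono nhdsWithin_le_nhds).mono fun _ h => h.le

/-- If a face contains two vertices `V S` and `V T`, it contains all vertices of the smallest
subcube through both: the segment from such a vertex to the midpoint of `V S` and `V T` can be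
prolonged inside `Q`, because every inequality tight at the midpoint is tight at the vertex. -/
lemma vertex_mem_face (h : IsCubical Q V L f g) {F : Set (Fin n → ℝ)} (hF : IsExposed ℝ Q F)
    {S T U : Finset (Fin d)} (hS : V S ∈ F) (hT : V T ∈ F) (h1 : S ∩ T ⊆ U) (h2 : U ⊆ S ∪ T) :
    V U ∈ F := by
  set m : Fin n → ℝ := midpoint ℝ (V S) (V T) with hm
  have hmF : m ∈ F := (hF.convex h.convex).midpoint_mem hS hT
  have hmQ : m ∈ Q := hF.subset hmF
  have hmid : ∀ φ : (Fin n → ℝ) →ᵃ[ℝ] ℝ, φ m = (φ (V S) + φ (V T)) / 2 := by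
    intro φ
    rw [hm, AffineMap.map_midpoint, midpoint_eq_smul_add]
    simp
    ring
  have hpos : ∀ S j, 0 ≤ f j (V S) ∧ 0 ≤ g j (V S) := fun S =>
    ((h.mem_iff _).1 (h.vertex_mem S)).2
  have hev : ∀ᶠ ε in nhdsWithin (0 : ℝ) (Set.Ioi 0),
      ∀ j, 0 ≤ f j (AffineMap.lineMap (V U) m (1 + ε)) ∧
        0 ≤ g j (AffineMap.lineMap (V U) m (1 + ε)) := by
    rw [Filter.eventually_all]
    intro j
    refine ((f j).eventually_nonneg_lineMap (((h.mem_iff _).1 hmQ).2 j).1 ?_).and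
      ((g j).eventually_nonneg_lineMap (((h.mem_iff _).1 hmQ).2 j).2 ?_)
    · intro h0
      rw [hmid] at h0
      have hS0 : f j (V S) = 0 := by linarith [(hpos S j).1, (hpos T j).1]
      have hT0 : f j (V T) = 0 := by linarith [(hpos S j).1, (hpos T j).1]
      rw [h.f_eq_zero] at hS0 hT0 ⊢
      intro hU
      rcases Finset.mem_union.1 (h2 hU) with h | h
      exacts [hS0 h, hT0 h]
    · intro h0
      rw [hmid] at h0
      have hS0 : g j (V S) = 0 := by linarith [(hpos S j).2, (hpos T j).2]
      have hT0 : g j (V T) = 0 := by linarith [(hpos S j).2, (hpos T j).2]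
      rw [h.g_eq_zero] at hS0 hT0 ⊢
      exact h1 (Finset.mem_inter.2 ⟨hS0, hT0⟩)
  obtain ⟨ε, hε, hε0⟩ := (hev.and self_mem_nhdsWithin).exists
  have hε0 : 0 < ε := hε0
  set z : Fin n → ℝ := AffineMap.lineMap (V U) m (1 + ε) with hz
  have hzQ : z ∈ Q := (h.mem_iff z).2
    ⟨AffineMap.lineMap_mem _ ((h.mem_iff _).1 (h.vertex_mem U)).1 ((h.mem_iff _).1 hmQ).1, hε⟩
  refine hF.isExtreme.left_mem_of_mem_openSegment (h.vertex_mem U) hzQ hmF ?_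
  rw [openSegment_eq_image_lineMap]
  refine ⟨(1 + ε)⁻¹, ⟨by positivity, inv_lt_one_of_one_lt₀ (by linarith)⟩, ?_⟩
  rw [hz, AffineMap.lineMap_lineMap_right, inv_mul_cancel₀ (by positivity),
    AffineMap.lineMap_apply_one]

/-- Every interval `[A, B]` of subsets is the vertex set of an exposed face: the face where the
inequalities `0 ≤ f j` for `j ∉ B` and `0 ≤ g j` for `j ∈ A` are tight. -/
lemma exists_face (h : IsCubical Q V L f g) {A B : Finset (Fin d)} (hAB : A ⊆ B) :
    ∃ F, IsExposed ℝ Q F ∧ {S | V S ∈ F} = Set.Icc A B := by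
  classical
  let φ : (Fin n → ℝ) →ᵃ[ℝ] ℝ := ∑ j ∈ Bᶜ, f j + ∑ j ∈ A, g j
  have hφ : ∀ x, φ x = ∑ j ∈ Bᶜ, f j x + ∑ j ∈ A, g j x := by
    intro x
    simp [φ, AffineMap.finset_sum_apply]
  have hφ0 : ∀ x ∈ Q, 0 ≤ φ x := by
    intro x hx
    rw [hφ]
    have := ((h.mem_iff x).1 hx).2
    exact add_nonneg (Finset.sum_nonneg fun j _ => (this j).1)
      (Finset.sum_nonneg fun j _ => (this j).2)
  have hφV : ∀ S, φ (V S) = 0 ↔ A ⊆ S ∧ S ⊆ B := by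
    intro S
    have hS := ((h.mem_iff _).1 (h.vertex_mem S)).2
    rw [hφ, add_eq_zero_iff_of_nonneg (Finset.sum_nonneg fun j _ => (hS j).1)
      (Finset.sum_nonneg fun j _ => (hS j).2),
      Finset.sum_eq_zero_iff_of_nonneg fun j _ => (hS j).1,
      Finset.sum_eq_zero_iff_of_nonneg fun j _ => (hS j).2]
    simp only [h.f_eq_zero, h.g_eq_zero, Finset.mem_compl]
    exact ⟨fun ⟨h1, h2⟩ => ⟨h2, fun j hj => by_contra fun hB => h1 j hB hj⟩,
      fun ⟨h1, h2⟩ => ⟨fun j hB hj => hB (h2 hj), h1⟩⟩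
  let l : StrongDual ℝ (Fin n → ℝ) := LinearMap.toContinuousLinearMap (-φ.linear)
  have hl : ∀ x y, l y ≤ l x ↔ φ x ≤ φ y := by
    intro x y
    have h1 : φ x - φ y = φ.linear (x - y) := by
      simpa using (φ.linearMap_vsub x y).symm
    have h2 : l x - l y = -(φ.linear (x - y)) := by
      simp only [l, LinearMap.coe_toContinuousLinearMap', LinearMap.neg_apply, map_sub]
      ring
    constructor <;> intro <;> linarith
  refine ⟨{x ∈ Q | ∀ y ∈ Q, l y ≤ l x}, fun _ => ⟨l, rfl⟩, ?_⟩
  ext S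
  simp only [Set.mem_ofPred_eq, Set.mem_Icc, hl, ← hφV]
  constructor
  · rintro ⟨h1, h2⟩
    refine le_antisymm ?_ (hφ0 _ h1)
    have := h2 _ (h.vertex_mem A)
    rwa [(hφV A).2 ⟨subset_rfl, hAB⟩] at this
  · intro h1
    exact ⟨h.vertex_mem S, fun y hy => h1 ▸ hφ0 y hy⟩

lemma vertices_eq_Icc (h : IsCubical Q V L f g) {F : Set (Fin n → ℝ)} (hF : IsExposed ℝ Q F) :
    {S | V S ∈ F} = ∅ ∨ ∃ A B, {S | V S ∈ F} = Set.Icc A B := by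
  classical
  rcases {S | V S ∈ F}.eq_empty_or_nonempty with h0 | ⟨S₀, hS₀⟩
  · exact Or.inl h0
  right
  let T : Finset (Finset (Fin d)) := Finset.univ.filter fun S => V S ∈ F
  have hT : T.Nonempty := ⟨S₀, by simpa [T] using hS₀⟩
  have hA : T.inf' hT id ∈ {S | V S ∈ F} := by
    refine Finset.inf'_mem _ (fun S hS U hU => ?_) _ _ _ fun S hS => by simpa [T] using hS
    exact h.vertex_mem_face hF hS hU subset_rfl
      (Finset.inter_subset_left.trans Finset.subset_union_left)
  have hB : T.sup' hT id ∈ {S | V S ∈ F} := by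
    refine Finset.sup'_mem _ (fun S hS U hU => ?_) _ _ _ fun S hS => by simpa [T] using hS
    exact h.vertex_mem_face hF hS hU
      (Finset.inter_subset_left.trans Finset.subset_union_left) subset_rfl
  refine ⟨T.inf' hT id, T.sup' hT id, Set.Subset.antisymm (fun S hS => ?_) fun S hS => ?_⟩
  · have hS : S ∈ T := by simpa [T] using hS
    exact ⟨Finset.inf'_le id hS, Finset.le_sup' id hS⟩
  · exact h.vertex_mem_face hF hA hB (Finset.inter_subset_left.trans hS.1)
      (hS.2.trans Finset.subset_union_right)

/-- A face is determined by its vertices, and the vertex sets of faces are the intervals of the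
Boolean lattice and `∅`. -/
theorem nonempty_orderIso (h : IsCubical Q V L f g) : Nonempty (FaceLattice Q ≃o CubeFaces d) := by
  let e : FaceLattice Q ↪o CubeFaces d := OrderEmbedding.ofMapLEIff
    (fun F => ⟨{S | V S ∈ F.1}, h.vertices_eq_Icc F.2⟩) fun F G => by
      constructor
      · intro hFG x hx
        have hF : IsExposed ℝ (convexHull ℝ (Set.range V)) F.1 := h.eq_convexHull ▸ F.2
        refine convexHull_min ?_ (G.2.convex h.convex) (hF.subset_convexHull_inter hx)
        rintro _ ⟨⟨S, rfl⟩, hS⟩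
        exact hFG hS
      · exact fun hFG S hS => hFG hS
  refine ⟨RelIso.ofSurjective e ?_⟩
  rintro ⟨𝒮, h𝒮⟩
  by_cases h0 : 𝒮 = ∅
  · exact ⟨⟨∅, isExposed_empty⟩, Subtype.ext (by simp [e, h0])⟩
  · obtain ⟨A, B, rfl⟩ := h𝒮.resolve_left h0
    have hAB : A ≤ B := Set.nonempty_Icc.1 (Set.nonempty_iff_ne_empty.2 h0)
    obtain ⟨F, hF, hFAB⟩ := h.exists_face hAB
    exact ⟨⟨F, hF⟩, Subtype.ext hFAB⟩

/-- An affine embedding carries cubical polytopes to cubical polytopes. -/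
theorem image {k : ℕ} (h : IsCubical Q V L f g) (φ : (Fin n → ℝ) →ᵃ[ℝ] (Fin k → ℝ))
    (ψ : (Fin k → ℝ) →ᵃ[ℝ] (Fin n → ℝ)) (hψ : ∀ x, ψ (φ x) = x) :
    IsCubical (φ '' Q) (fun S => φ (V S)) (L.map φ) (fun j => (f j).comp ψ)
      (fun j => (g j).comp ψ) where
  eq_convexHull := by
    rw [h.eq_convexHull, AffineMap.image_convexHull, ← Set.range_comp]
    rfl
  mem_iff := by
    intro x
    simp only [Set.mem_image, AffineSubspace.mem_map, AffineMap.comp_apply, h.mem_iff]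
    constructor
    · rintro ⟨y, hy, rfl⟩
      exact ⟨⟨y, hy.1, rfl⟩, by simpa [hψ] using hy.2⟩
    · rintro ⟨⟨y, hy, rfl⟩, h'⟩
      exact ⟨y, ⟨hy, by simpa [hψ] using h'⟩, rfl⟩
  f_eq_zero := by simp [hψ, h.f_eq_zero]
  g_eq_zero := by simp [hψ, h.g_eq_zero]

end IsCubical

/-- The coordinate `j` as an affine function. -/
def coordMap {n : ℕ} (j : Fin n) : (Fin n → ℝ) →ᵃ[ℝ] ℝ :=
  (LinearMap.proj j : (Fin n → ℝ) →ₗ[ℝ] ℝ).toAffineMap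

lemma isCubical_unitCube (d : ℕ) :
    IsCubical (unitCube d) (fun S i => if i ∈ S then 1 else 0) ⊤ coordMap
      (fun j => AffineMap.const ℝ _ 1 - coordMap j) where
  eq_convexHull := by
    have h : Set.range (fun (S : Finset (Fin d)) (i : Fin d) => if i ∈ S then (1 : ℝ) else 0) =
        Set.univ.pi fun _ => {0, 1} := by
      ext x
      constructor
      · rintro ⟨S, rfl⟩ i -
        by_cases hi : i ∈ S <;> simp [hi]
      · intro hx
        refine ⟨Finset.univ.filter fun i => x i = 1, ?_⟩
        funext i
        rcases hx i trivial with h | h <;> simp [show x i = _ from h]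
    rw [h, convexHull_pi]
    simp only [convexHull_pair, segment_eq_Icc zero_le_one, Set.pi_univ_Icc]
    rfl
  mem_iff := by
    intro x
    simp only [unitCube, Set.mem_Icc, Pi.le_def, coordMap]
    simp [forall_and]
  f_eq_zero := by simp [coordMap]
  g_eq_zero := by
    intro j S
    by_cases h : j ∈ S <;> simp [coordMap, h]

/-! ### The Pitman–Stanley polytope -/

/-- The largest `i + 1` with `i ∈ S` and `i < k`, or `0` if there is none. Counting positions from
`1`, it is the last element of `S` up to position `k`. -/
def lastBefore {d : ℕ} (S : Finset (Fin d)) : ℕ → ℕ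
  | 0 => 0
  | k + 1 => if ∃ h : k < d, (⟨k, h⟩ : Fin d) ∈ S then k + 1 else lastBefore S k

section lastBefore

variable {d : ℕ} {S : Finset (Fin d)}

lemma lastBefore_le (S : Finset (Fin d)) (k : ℕ) : lastBefore S k ≤ k := by
  induction k with
  | zero => simp [lastBefore]
  | succ k ih =>
    rw [lastBefore]
    split_ifs <;> omega

lemma lastBefore_succ_of_mem {i : Fin d} (h : i ∈ S) : lastBefore S (i + 1) = i + 1 := by
  rw [lastBefore, if_pos ⟨i.2, h⟩]

lemma lastBefore_succ_of_notMem {i : Fin d} (h : i ∉ S) :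
    lastBefore S (i + 1) = lastBefore S i := by
  rw [lastBefore, if_neg fun ⟨_, h'⟩ => h h']

lemma lastBefore_mono (S : Finset (Fin d)) : Monotone (lastBefore S) := by
  refine monotone_nat_of_le_succ fun k => ?_
  rw [lastBefore]
  split_ifs
  · exact (lastBefore_le S k).trans k.le_succ
  · exact le_rfl

lemma lastBefore_congr {T : Finset (Fin d)} {k : ℕ}
    (h : ∀ i : Fin d, (i : ℕ) < k → (i ∈ S ↔ i ∈ T)) : lastBefore S k = lastBefore T k := by
  induction k with
  | zero => rfl
  | succ k ih =>
    rw [lastBefore, lastBefore, ih fun i hi => h i (by omega)]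
    have : (∃ hk : k < d, (⟨k, hk⟩ : Fin d) ∈ S) ↔ ∃ hk : k < d, (⟨k, hk⟩ : Fin d) ∈ T :=
      exists_congr fun hk => h ⟨k, hk⟩ (Nat.lt_succ_self k)
    simp only [this]

/-- An element of `S` in a position before `k` is at most the last one. -/
lemma lt_lastBefore_of_mem {i : Fin d} (hi : i ∈ S) {k : ℕ} (hik : (i : ℕ) < k) :
    (i : ℕ) < lastBefore S k := by
  have := lastBefore_mono S (show (i : ℕ) + 1 ≤ k from hik)
  rw [lastBefore_succ_of_mem hi] at this
  omega

lemma lastBefore_eq_zero_or (S : Finset (Fin d)) (k : ℕ) :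
    lastBefore S k = 0 ∨ ∃ i ∈ S, (i : ℕ) < k ∧ lastBefore S k = i + 1 := by
  induction k with
  | zero => exact Or.inl rfl
  | succ k ih =>
    rw [lastBefore]
    split_ifs with h
    · obtain ⟨hk, hS⟩ := h
      exact Or.inr ⟨⟨k, hk⟩, hS, Nat.lt_succ_self k, rfl⟩
    · rcases ih with h0 | ⟨i, hi, hik, he⟩
      · exact Or.inl h0
      · exact Or.inr ⟨i, hi, by omega, he⟩

end lastBefore

lemma Fin.sum_Iic_eq_sum_range {M : Type*} [AddCommMonoid M] {n : ℕ} (u : ℕ → M) (j : Fin n) :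
    ∑ i ∈ Finset.Iic j, u i = ∑ k ∈ Finset.range (j + 1), u k := by
  rw [Nat.range_succ_eq_Iic, ← Fin.map_valEmbedding_Iic, Finset.sum_map]
  rfl

/-- The vertex of `PS_d(1, …, 1)` belonging to `S`: the coordinates outside `S` vanish, and the
partial sum up to each position in `S` is as large as possible. -/
def psVertex {d : ℕ} (S : Finset (Fin d)) (i : Fin d) : ℝ :=
  if i ∈ S then (i : ℝ) + 1 - lastBefore S i else 0

section psVertex

variable {d : ℕ} {S : Finset (Fin d)}

lemma psVertex_eq_sub (S : Finset (Fin d)) (i : Fin d) :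
    psVertex S i = (lastBefore S (i + 1) : ℝ) - lastBefore S i := by
  unfold psVertex
  split_ifs with h
  · rw [lastBefore_succ_of_mem h]
    push_cast
    rfl
  · rw [lastBefore_succ_of_notMem h, sub_self]

lemma sum_Iic_psVertex (S : Finset (Fin d)) (j : Fin d) :
    ∑ i ∈ Finset.Iic j, psVertex S i = lastBefore S (j + 1) := by
  simp only [psVertex_eq_sub]
  rw [Fin.sum_Iic_eq_sum_range (fun k => (lastBefore S (k + 1) : ℝ) - lastBefore S k) j,
    Finset.sum_range_sub (fun k => (lastBefore S k : ℝ))]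
  simp [lastBefore]

lemma psVertex_nonneg (S : Finset (Fin d)) (i : Fin d) : 0 ≤ psVertex S i := by
  rw [psVertex_eq_sub, sub_nonneg]
  exact_mod_cast lastBefore_mono S (Nat.le_succ _)

end psVertex

lemma mem_pitmanStanley_const {d : ℕ} {c : ℝ} {x : Fin d → ℝ} :
    x ∈ pitmanStanley d (fun _ => c) ↔
      (∀ i, 0 ≤ x i) ∧ ∀ j : Fin d, ∑ i ∈ Finset.Iic j, x i ≤ c * ((j : ℝ) + 1) := by
  have : ∀ j : Fin d, ∑ _i ∈ Finset.Iic j, c = c * ((j : ℝ) + 1) := by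
    intro j
    simp [mul_comm]
  simp only [pitmanStanley, this]
  rfl

lemma psVertex_mem {d : ℕ} (S : Finset (Fin d)) :
    psVertex S ∈ pitmanStanley d (fun _ => 1) := by
  refine mem_pitmanStanley_const.2 ⟨psVertex_nonneg S, fun j => ?_⟩
  rw [sum_Iic_psVertex, one_mul]
  exact_mod_cast lastBefore_le S (j + 1)

lemma convex_pitmanStanley (d : ℕ) (c : Fin d → ℝ) : Convex ℝ (pitmanStanley d c) := by
  have : pitmanStanley d c = (⋂ i, {x | 0 ≤ x i}) ∩
      ⋂ j, {x | ∑ i ∈ Finset.Iic j, x i ≤ ∑ i ∈ Finset.Iic j, c i} := by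
    ext x
    simp [pitmanStanley]
  rw [this]
  refine (convex_iInter fun i => ?_).inter (convex_iInter fun j => ?_)
  · exact convex_halfSpace_ge (LinearMap.proj i : (Fin d → ℝ) →ₗ[ℝ] ℝ).isLinear 0
  · have h := convex_halfSpace_le
      (∑ i ∈ Finset.Iic j, (LinearMap.proj i : (Fin d → ℝ) →ₗ[ℝ] ℝ)).isLinear
      (∑ i ∈ Finset.Iic j, c i)
    simpa [LinearMap.sum_apply] using h

/-- The affine map that replaces the coordinate `x k` by the largest value it can have in
`PS_d(1, …, 1)`, given the coordinates before it, provided that `x k = 0`. -/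
def raise {d : ℕ} (k : Fin d) : (Fin d → ℝ) →ᵃ[ℝ] (Fin d → ℝ) :=
  (LinearMap.id - (∑ i ∈ Finset.Iic k,
    (LinearMap.proj i : (Fin d → ℝ) →ₗ[ℝ] ℝ)).smulRight (Pi.single k 1)).toAffineMap +
  AffineMap.const ℝ (Fin d → ℝ) (((k : ℝ) + 1) • (Pi.single k 1 : Fin d → ℝ))

lemma raise_apply {d : ℕ} (k : Fin d) (x : Fin d → ℝ) :
    raise k x = x + ((k : ℝ) + 1 - ∑ i ∈ Finset.Iic k, x i) • Pi.single k 1 := by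
  simp only [raise, AffineMap.coe_add, Pi.add_apply, LinearMap.coe_toAffineMap,
    LinearMap.sub_apply, LinearMap.id_apply, LinearMap.smulRight_apply, LinearMap.sum_apply,
    LinearMap.proj_apply, AffineMap.const_apply, sub_smul]
  abel

lemma raise_psVertex {d : ℕ} {k : Fin d} {S : Finset (Fin d)} (hS : ∀ i ∈ S, i < k) :
    raise k (psVertex S) = psVertex (insert k S) := by
  have hk : k ∉ S := fun h => lt_irrefl k (hS k h)
  funext i
  rw [raise_apply, sum_Iic_psVertex, lastBefore_succ_of_notMem hk]
  rcases lt_trichotomy i k with hi | rfl | hi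
  · have h : lastBefore (insert k S) i = lastBefore S i := lastBefore_congr fun j hj => by
      have : j ≠ k := fun h => by
        subst h
        exact absurd (Fin.lt_def.1 hi) (by omega)
      simp [this]
    simp [psVertex, hi.ne, h]
  · have h : lastBefore (insert i S) i = lastBefore S i := lastBefore_congr fun j hj => by
      have : j ≠ i := fun h => by
        subst h
        exact absurd hj (lt_irrefl _)
      simp [this]
    simp [psVertex, hk, h]
  · have : i ∉ S := fun h => lt_asymm hi (hS i h)
    simp [psVertex, hi.ne', this]

/-- The points of `PS_d(1, …, 1)` supported in the first `k` coordinates are convex combinations of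
vertices: the last nonzero coordinate is an interpolation between its extreme values, which are
taken by affine maps that preserve the vertices. -/
lemma mem_convexHull_psVertex_of_support {d : ℕ} (k : ℕ) (hk : k ≤ d) {x : Fin d → ℝ}
    (hx : x ∈ pitmanStanley d (fun _ => 1)) (hsupp : ∀ i : Fin d, k ≤ i → x i = 0) :
    x ∈ convexHull ℝ (psVertex '' {S | ∀ i ∈ S, (i : ℕ) < k}) := by
  induction k generalizing x with
  | zero =>
    have : x = psVertex ∅ := by
      funext i
      simp [psVertex, hsupp]
    exact this ▸ subset_convexHull ℝ _ ⟨∅, by simp, rfl⟩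
  | succ k ih =>
    rw [mem_pitmanStanley_const] at hx
    obtain ⟨hx0, hxs⟩ := hx
    set i₀ : Fin d := ⟨k, hk⟩ with hi₀
    set x' : Fin d → ℝ := Function.update x i₀ 0 with hx'
    have hle : x' ≤ x := by
      rw [hx', update_le_self_iff]
      exact hx0 i₀
    have hx'mem : x' ∈ pitmanStanley d (fun _ => 1) := by
      refine mem_pitmanStanley_const.2 ⟨fun i => ?_, fun j =>
        (Finset.sum_le_sum fun i _ => hle i).trans (hxs j)⟩
      by_cases hi : i = i₀ <;> simp [hx', hi, hx0, Function.update_of_ne]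
    have hx'supp : ∀ i : Fin d, k ≤ i → x' i = 0 := by
      intro i hi
      by_cases h : i = i₀
      · simp [hx', h]
      · have : (i : ℕ) ≠ k := fun h' => h (Fin.ext h')
        rw [hx', Function.update_of_ne h, hsupp i (by omega)]
    have hmem := ih (by omega) hx'mem hx'supp
    set W := psVertex '' {S : Finset (Fin d) | ∀ i ∈ S, (i : ℕ) < k}
    set W' := psVertex '' {S : Finset (Fin d) | ∀ i ∈ S, (i : ℕ) < k + 1}
    have h0 : x' ∈ convexHull ℝ W' := convexHull_mono
      (Set.image_mono fun S hS i hi => (hS i hi).trans (Nat.lt_succ_self k)) hmem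
    have h1 : raise i₀ x' ∈ convexHull ℝ W' := by
      have h2 : raise i₀ x' ∈ raise i₀ '' convexHull ℝ W := ⟨x', hmem, rfl⟩
      rw [AffineMap.image_convexHull] at h2
      refine convexHull_mono ?_ h2
      rintro _ ⟨_, ⟨S, hS, rfl⟩, rfl⟩
      refine ⟨insert i₀ S, fun i hi => ?_, (raise_psVertex fun i hi => hS i hi).symm⟩
      rcases Finset.mem_insert.1 hi with rfl | hi
      · exact Nat.lt_succ_self k
      · exact (hS i hi).trans (Nat.lt_succ_self k)
    set D : ℝ := (i₀ : ℝ) + 1 - ∑ i ∈ Finset.Iic i₀, x' i with hD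
    have hsum : ∑ i ∈ Finset.Iic i₀, x i = x i₀ + ∑ i ∈ Finset.Iic i₀, x' i := by
      rw [hx', Finset.sum_update_of_mem (by simp),
        ← Finset.sum_sdiff (s₁ := {i₀}) (by simp : ({i₀} : Finset (Fin d)) ⊆ Finset.Iic i₀)]
      simp [add_comm]
    have hxD : x i₀ ≤ D := by linarith [hxs i₀]
    have hx_eq : x = x' + x i₀ • Pi.single i₀ (1 : ℝ) := by
      funext i
      by_cases h : i = i₀
      · subst h
        simp [hx']
      · simp [hx', h]
    -- if `D = 0` the quotient `x i₀ / D` is `0`, which is then the right weight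
    have hcomb : x = (1 - x i₀ / D) • x' + (x i₀ / D) • raise i₀ x' := by
      have hq : x i₀ / D * D = x i₀ := by
        by_cases h : D = 0
        · have : x i₀ = 0 := le_antisymm (h ▸ hxD) (hx0 i₀)
          simp [this]
        · exact div_mul_cancel₀ _ h
      rw [raise_apply, ← hD, smul_add, smul_smul, hq, ← add_assoc, ← add_smul, sub_add_cancel,
        one_smul]
      exact hx_eq
    have hDnn : 0 ≤ D := (hx0 i₀).trans hxD
    rw [hcomb]
    exact convex_convexHull ℝ W' h0 h1 (sub_nonneg.2 (div_le_one_of_le₀ hxD hDnn))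
      (div_nonneg (hx0 i₀) hDnn) (sub_add_cancel _ _)

theorem pitmanStanley_eq_convexHull (d : ℕ) :
    pitmanStanley d (fun _ => 1) = convexHull ℝ (Set.range psVertex) := by
  refine Set.Subset.antisymm (fun x hx => ?_) (convexHull_min ?_ (convex_pitmanStanley d _))
  · refine convexHull_mono (Set.image_subset_range _ _)
      (mem_convexHull_psVertex_of_support d le_rfl hx fun i hi => ?_)
    exact absurd i.2 (not_lt.2 hi)
  · rintro _ ⟨S, rfl⟩
    exact psVertex_mem S

/-- The slack of the inequality for the partial sum up to position `j`. -/
def partialSumSlack {d : ℕ} (j : Fin d) : (Fin d → ℝ) →ᵃ[ℝ] ℝ :=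
  AffineMap.const ℝ _ ((j : ℝ) + 1) -
    (∑ i ∈ Finset.Iic j, (LinearMap.proj i : (Fin d → ℝ) →ₗ[ℝ] ℝ)).toAffineMap

lemma partialSumSlack_apply {d : ℕ} (j : Fin d) (x : Fin d → ℝ) :
    partialSumSlack j x = (j : ℝ) + 1 - ∑ i ∈ Finset.Iic j, x i := by
  simp [partialSumSlack]

theorem isCubical_pitmanStanley (d : ℕ) :
    IsCubical (pitmanStanley d (fun _ => 1)) psVertex ⊤ coordMap partialSumSlack where
  eq_convexHull := pitmanStanley_eq_convexHull d
  mem_iff := by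
    intro x
    simp only [mem_pitmanStanley_const, one_mul, partialSumSlack_apply, sub_nonneg, coordMap,
      AffineSubspace.mem_top, true_and, forall_and]
    rfl
  f_eq_zero := by
    intro j S
    have h : ((lastBefore S j : ℕ) : ℝ) ≤ j := by exact_mod_cast lastBefore_le S j
    change psVertex S j = 0 ↔ _
    unfold psVertex
    split_ifs with hj
    · simp only [hj, not_true_eq_false, iff_false]
      linarith
    · simp [hj]
  g_eq_zero := by
    intro j S
    rw [partialSumSlack_apply, sum_Iic_psVertex]
    by_cases hj : j ∈ S
    · simp [hj, lastBefore_succ_of_mem]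
    · have h : ((lastBefore S j : ℕ) : ℝ) ≤ j := by exact_mod_cast lastBefore_le S j
      rw [lastBefore_succ_of_notMem hj]
      simp only [hj, iff_false]
      linarith

/-! ### Permutations avoiding 123 and 132 -/

lemma mem_Av_iff {n : ℕ} {σ : Equiv.Perm (Fin n)} :
    σ ∈ Av n {pattern123, pattern132} ↔
      ∀ i j k, i < j → j < k → ¬(σ i < σ j ∧ σ i < σ k) := by
  have hAv : σ ∈ Av n {pattern123, pattern132} ↔
      ¬ContainsPattern σ (1 : Equiv.Perm (Fin 3)) ∧
        ¬ContainsPattern σ (Equiv.swap 1 2 : Equiv.Perm (Fin 3)) := by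
    simp [Av, pattern123, pattern132]
  rw [hAv]
  constructor
  · rintro ⟨h1, h2⟩ i j k hij hjk ⟨h3, h4⟩
    let f : Fin 3 ↪o Fin n := OrderEmbedding.ofStrictMono ![i, j, k] (by
      rw [Fin.strictMono_iff_lt_succ]
      intro a
      fin_cases a
      · exact hij
      · exact hjk)
    have hf0 : f 0 = i := rfl
    have hf1 : f 1 = j := rfl
    have hf2 : f 2 = k := rfl
    rcases lt_or_gt_of_ne (σ.injective.ne hjk.ne) with h | h
    · refine h1 ⟨f, fun a b => ?_⟩
      fin_cases a <;> fin_cases b <;>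
        simp [hf0, hf1, hf2, h, h3, h4, h.le, h3.le, h4.le]
    · refine h2 ⟨f, fun a b => ?_⟩
      have e0 : Equiv.swap (1 : Fin 3) 2 0 = 0 := by decide
      fin_cases a <;> fin_cases b <;>
        simp [hf0, hf1, hf2, h, h3, h4, h.le, h3.le, h4.le, e0]
  · intro h
    refine ⟨?_, ?_⟩ <;>
    · rintro ⟨f, hf⟩
      exact h (f 0) (f 1) (f 2) (f.strictMono (by decide)) (f.strictMono (by decide))
        ⟨(hf 0 1).2 (by decide), (hf 0 2).2 (by decide)⟩

/-- The linear part of `liftMap`: a last coordinate is appended that makes the coordinate sum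
zero. -/
def liftLinear (d : ℕ) : (Fin d → ℝ) →ₗ[ℝ] (Fin (d + 1) → ℝ) where
  toFun x := Fin.snoc (α := fun _ => ℝ) x (-∑ i, x i)
  map_add' x y := by
    funext i
    refine Fin.lastCases ?_ (fun i => ?_) i
    · simp [Finset.sum_add_distrib, add_comm]
    · simp
  map_smul' c x := by
    funext i
    refine Fin.lastCases ?_ (fun i => ?_) i
    · simp [Finset.mul_sum]
    · simp

@[simp] lemma liftLinear_castSucc {d : ℕ} (x : Fin d → ℝ) (i : Fin d) :
    liftLinear d x i.castSucc = x i := by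
  simp [liftLinear]

@[simp] lemma liftLinear_last {d : ℕ} (x : Fin d → ℝ) :
    liftLinear d x (Fin.last d) = -∑ i, x i := by
  simp [liftLinear]

/-- The affine map `x ↦ (x₁ + m d, …, x_d + m, m (d + 1) - (x₁ + ⋯ + x_d))`. For `m = 1` it is the
inverse of the projection `projShift (d + 1)` on the affine hull of the permutohedron; for general
`m` it parametrizes the affine hull of the `m`-th dilate (`smul_liftMap`). -/
def liftMap (d : ℕ) (m : ℝ) : (Fin d → ℝ) →ᵃ[ℝ] (Fin (d + 1) → ℝ) :=
  (liftLinear d).toAffineMap +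
    AffineMap.const ℝ (Fin d → ℝ) (fun i : Fin (d + 1) =>
      m * ((d + 1 : ℝ) - if i = Fin.last d then 0 else (i + 1 : ℝ)))

lemma liftMap_eq {d : ℕ} (m : ℝ) (x : Fin d → ℝ) :
    liftMap d m x = liftLinear d x + liftMap d m 0 := by
  simp [liftMap]

@[simp] lemma liftMap_castSucc {d : ℕ} (m : ℝ) (x : Fin d → ℝ) (i : Fin d) :
    liftMap d m x i.castSucc = x i + m * ((d : ℝ) - i) := by
  simp [liftMap, Fin.castSucc_ne_last]

@[simp] lemma liftMap_last {d : ℕ} (m : ℝ) (x : Fin d → ℝ) :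
    liftMap d m x (Fin.last d) = m * ((d : ℝ) + 1) - ∑ i, x i := by
  simp [liftMap]
  ring

lemma smul_liftMap {d : ℕ} (m : ℝ) (x : Fin d → ℝ) :
    m • liftMap d 1 x = liftMap d m (m • x) := by
  funext i
  refine Fin.lastCases ?_ (fun i => ?_) i
  · simp [mul_sub, Finset.mul_sum]
  · simp [mul_add]

/-- The projection `projShift (d + 1)` as an affine map. -/
def projMap (d : ℕ) : (Fin (d + 1) → ℝ) →ᵃ[ℝ] (Fin d → ℝ) :=
  (LinearMap.funLeft ℝ ℝ (Fin.castSucc : Fin d → Fin (d + 1))).toAffineMap -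
    AffineMap.const ℝ _ (fun i : Fin d => (d : ℝ) - i)

lemma projMap_apply {d : ℕ} (a : Fin (d + 1) → ℝ) (i : Fin d) :
    projMap d a i = a i.castSucc - ((d : ℝ) - i) := by
  simp [projMap, LinearMap.funLeft_apply]

lemma projShift_succ (d : ℕ) : projShift (d + 1) = projMap d := by
  funext a i
  rw [projMap_apply]
  simp only [projShift]
  push_cast
  have : (Fin.castLE (Nat.sub_le (d + 1) 1) i) = (i : Fin d).castSucc := rfl
  rw [this]
  ring

lemma projMap_liftMap {d : ℕ} (x : Fin d → ℝ) : projMap d (liftMap d 1 x) = x := by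
  funext i
  simp [projMap_apply]

/-- The coordinates of a permutation have the same sum as those of the decreasing one. -/
lemma liftMap_projMap_permPoint {d : ℕ} (σ : Equiv.Perm (Fin (d + 1))) :
    liftMap d 1 (projMap d (permPoint σ)) = permPoint σ := by
  funext i
  refine Fin.lastCases ?_ (fun i => ?_) i
  · have h1 : ∑ i, permPoint σ i = ∑ i : Fin (d + 1), ((d : ℝ) + 1 - i) := by
      unfold permPoint
      rw [Equiv.sum_comp σ fun i : Fin (d + 1) => ((i : ℕ) : ℝ) + 1, ← Equiv.sum_comp Fin.revPerm]
      refine Finset.sum_congr rfl fun i _ => ?_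
      have : ((Fin.revPerm i : Fin (d + 1)) : ℕ) + (i : ℕ) = d := by
        simp only [Fin.revPerm_apply, Fin.val_rev]
        omega
      have : ((Fin.revPerm i : Fin (d + 1)) : ℝ) + (i : ℝ) = d := by exact_mod_cast this
      linarith
    rw [Fin.sum_univ_castSucc, Fin.sum_univ_castSucc] at h1
    simp only [liftMap_last, projMap_apply, Finset.sum_sub_distrib, Fin.val_castSucc, Fin.val_last,
      Finset.sum_const, Finset.card_univ, Fintype.card_fin, nsmul_eq_mul] at h1 ⊢
    linarith
  · simp [projMap_apply]

lemma val_ge_of_mem_Av {d : ℕ} {σ : Equiv.Perm (Fin (d + 1))}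
    (hσ : σ ∈ Av (d + 1) {pattern123, pattern132}) (i : Fin (d + 1)) :
    d ≤ (σ i : ℕ) + i + 1 := by
  rw [mem_Av_iff] at hσ
  have h1 : ((Finset.Ioi i).filter fun j => σ i < σ j).card ≤ 1 := by
    rw [Finset.card_le_one]
    intro j hj k hk
    simp only [Finset.mem_filter, Finset.mem_Ioi] at hj hk
    by_contra hne
    rcases lt_or_gt_of_ne hne with h | h
    · exact hσ i j k hj.1 h ⟨hj.2, hk.2⟩
    · exact hσ i k j hk.1 h ⟨hk.2, hj.2⟩
  have h2 : ((Finset.Ioi i).filter fun j => ¬σ i < σ j).card ≤ (Finset.Iio (σ i)).card := by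
    refine Finset.card_le_card_of_injOn σ (fun j hj => ?_) σ.injective.injOn
    simp only [Finset.coe_filter, Finset.mem_Ioi] at hj
    have hne : σ j ≠ σ i := σ.injective.ne hj.1.ne'
    simpa using lt_of_le_of_ne (not_lt.1 hj.2) hne
  have h3 := Finset.card_filter_add_card_filter_not (s := Finset.Ioi i) fun j => σ i < σ j
  rw [Fin.card_Ioi] at h3
  rw [Fin.card_Iio] at h2
  omega

/-- The first entries of a permutation are at most as large in total as the largest entries. -/
lemma sum_Iic_perm_le {d : ℕ} (σ : Equiv.Perm (Fin (d + 1))) (j : Fin d) :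
    ∑ i ∈ Finset.Iic j, ((σ i.castSucc : ℕ) : ℝ) ≤ ∑ i ∈ Finset.Iic j, ((d : ℝ) - i) := by
  let e : Fin d → ℤ := fun i => ((σ i.castSucc : ℕ) : ℤ)
  have he : Function.Injective e := fun a b h => by
    have h : ((σ a.castSucc : ℕ) : ℤ) = ((σ b.castSucc : ℕ) : ℤ) := h
    exact Fin.castSucc_injective d (σ.injective (Fin.ext (by exact_mod_cast h)))
  have h := Finset.sum_le_sum_range (s := (Finset.Iic j).image e) (c := d) (by
    intro x hx
    obtain ⟨i, -, rfl⟩ := Finset.mem_image.1 hx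
    have := (σ i.castSucc).2
    simp only [e]
    omega)
  rw [Finset.sum_image he.injOn, Finset.card_image_of_injective _ he, Fin.card_Iic] at h
  have h' : ((∑ i ∈ Finset.Iic j, e i : ℤ) : ℝ) ≤
      ((∑ k ∈ Finset.range (j + 1), ((d : ℤ) - k) : ℤ) : ℝ) := by exact_mod_cast h
  rw [Fin.sum_Iic_eq_sum_range (fun k => (d : ℝ) - k) j]
  push_cast at h'
  simpa [e] using h'

lemma projMap_permPoint_mem {d : ℕ} {σ : Equiv.Perm (Fin (d + 1))}
    (hσ : σ ∈ Av (d + 1) {pattern123, pattern132}) :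
    projMap d (permPoint σ) ∈ pitmanStanley d (fun _ => 1) := by
  refine mem_pitmanStanley_const.2 ⟨fun i => ?_, fun j => ?_⟩
  · have h : (d : ℝ) ≤ (σ i.castSucc : ℕ) + (i : ℕ) + 1 := by
      exact_mod_cast val_ge_of_mem_Av hσ i.castSucc
    simp only [projMap_apply, permPoint]
    linarith
  · have h := sum_Iic_perm_le σ j
    simp only [projMap_apply, permPoint, Finset.sum_sub_distrib, Finset.sum_add_distrib,
      Finset.sum_const, Fin.card_Iic, nsmul_eq_mul] at h ⊢
    push_cast at h ⊢
    linarith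

/-- The entries of the permutation of a subset `S`, counted from `0` downwards from the largest: a
position in `S`, and the last position, receives the largest entry that is left, and every other
position receives the second largest. -/
def avDepth {d : ℕ} (S : Finset (Fin d)) (i : Fin (d + 1)) : Fin (d + 1) :=
  if h : ∃ h : (i : ℕ) < d, (⟨i, h⟩ : Fin d) ∉ S then ⟨i + 1, Nat.succ_lt_succ h.1⟩
  else ⟨lastBefore S i, (lastBefore_le S i).trans_lt i.2⟩

lemma avDepth_castSucc {d : ℕ} (S : Finset (Fin d)) (i : Fin d) :
    (avDepth S i.castSucc : ℝ) = (i : ℝ) + 1 - psVertex S i := by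
  unfold avDepth psVertex
  by_cases hi : i ∈ S <;> simp [hi]

/-- If both `i < k` receive the largest entry that is left, then `i ∈ S`, because `i` is not the
last position, and only depths greater than `i` are left after position `i`. -/
lemma lt_avDepth_of_lt {d : ℕ} {S : Finset (Fin d)} {i k : Fin (d + 1)} (hik : i < k)
    (hi : ¬∃ h : (i : ℕ) < d, (⟨i, h⟩ : Fin d) ∉ S)
    (hk : ¬∃ h : (k : ℕ) < d, (⟨k, h⟩ : Fin d) ∉ S) :
    (i : ℕ) < avDepth S k := by
  have hid : (i : ℕ) < d := by
    have := k.2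
    have := Fin.lt_def.1 hik
    omega
  have hiS : (⟨i, hid⟩ : Fin d) ∈ S := by
    by_contra h
    exact hi ⟨hid, h⟩
  rw [avDepth, dif_neg hk]
  exact lt_lastBefore_of_mem hiS (Fin.lt_def.1 hik)

lemma avDepth_le {d : ℕ} {S : Finset (Fin d)} {i : Fin (d + 1)}
    (hi : ¬∃ h : (i : ℕ) < d, (⟨i, h⟩ : Fin d) ∉ S) : (avDepth S i : ℕ) ≤ i := by
  rw [avDepth, dif_neg hi]
  exact lastBefore_le S i

lemma avDepth_of_notMem {d : ℕ} {S : Finset (Fin d)} {i : Fin (d + 1)}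
    (hi : ∃ h : (i : ℕ) < d, (⟨i, h⟩ : Fin d) ∉ S) : (avDepth S i : ℕ) = i + 1 := by
  rw [avDepth, dif_pos hi]

lemma avDepth_ne_of_lt {d : ℕ} (S : Finset (Fin d)) {i k : Fin (d + 1)} (hik : i < k) :
    avDepth S i ≠ avDepth S k := by
  intro h
  have h' : (avDepth S i : ℕ) = avDepth S k := congrArg _ h
  have hik' := Fin.lt_def.1 hik
  by_cases hi : ∃ h : (i : ℕ) < d, (⟨i, h⟩ : Fin d) ∉ S
  · rw [avDepth_of_notMem hi] at h'
    by_cases hk : ∃ h : (k : ℕ) < d, (⟨k, h⟩ : Fin d) ∉ S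
    · rw [avDepth_of_notMem hk] at h'
      omega
    · rw [avDepth, dif_neg hk] at h'
      have h' : (i : ℕ) + 1 = lastBefore S k := h'
      rcases lastBefore_eq_zero_or S k with h0 | ⟨j, hj, -, he⟩
      · omega
      · obtain ⟨hid, hiS⟩ := hi
        have : j = ⟨i, hid⟩ := Fin.ext (by simp only; omega)
        exact hiS (this ▸ hj)
  · by_cases hk : ∃ h : (k : ℕ) < d, (⟨k, h⟩ : Fin d) ∉ S
    · rw [avDepth_of_notMem hk] at h'
      have := avDepth_le hi
      omega
    · have := avDepth_le hi
      have := lt_avDepth_of_lt hik hi hk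
      omega

lemma avDepth_injective {d : ℕ} (S : Finset (Fin d)) : Function.Injective (avDepth S) := by
  intro i k h
  by_contra hne
  rcases lt_or_gt_of_ne hne with hlt | hlt
  · exact avDepth_ne_of_lt S hlt h
  · exact avDepth_ne_of_lt S hlt h.symm

/-- The permutation avoiding 123 and 132 that belongs to the subset `S`. -/
noncomputable def avPerm {d : ℕ} (S : Finset (Fin d)) : Equiv.Perm (Fin (d + 1)) :=
  (Equiv.ofBijective _ (Finite.injective_iff_bijective.1 (avDepth_injective S))).trans Fin.revPerm

lemma avPerm_apply {d : ℕ} (S : Finset (Fin d)) (i : Fin (d + 1)) :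
    avPerm S i = (avDepth S i).rev := rfl

lemma avPerm_mem {d : ℕ} (S : Finset (Fin d)) :
    avPerm S ∈ Av (d + 1) {pattern123, pattern132} := by
  rw [mem_Av_iff]
  rintro i j k hij hjk ⟨h1, h2⟩
  rw [avPerm_apply, avPerm_apply, Fin.rev_lt_rev, Fin.lt_def] at h1 h2
  have hi : (avDepth S i : ℕ) ≤ i + 1 := by
    by_cases hi : ∃ h : (i : ℕ) < d, (⟨i, h⟩ : Fin d) ∉ S
    · exact (avDepth_of_notMem hi).le
    · exact (avDepth_le hi).trans (Nat.le_succ _)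
  have hij' := Fin.lt_def.1 hij
  have hjk' := Fin.lt_def.1 hjk
  -- both later depths are at most `i`, so both positions receive
  -- the largest entry that is left
  have hj : ¬∃ h : (j : ℕ) < d, (⟨j, h⟩ : Fin d) ∉ S := fun h => by
    rw [avDepth_of_notMem h] at h1
    omega
  have hk : ¬∃ h : (k : ℕ) < d, (⟨k, h⟩ : Fin d) ∉ S := fun h => by
    rw [avDepth_of_notMem h] at h2
    omega
  have := lt_avDepth_of_lt hjk hj hk
  omega

lemma projMap_permPoint_avPerm {d : ℕ} (S : Finset (Fin d)) :
    projMap d (permPoint (avPerm S)) = psVertex S := by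
  funext i
  have h : ((avPerm S i.castSucc : ℕ) : ℝ) + (avDepth S i.castSucc : ℕ) = d := by
    have : (avPerm S i.castSucc : ℕ) + (avDepth S i.castSucc : ℕ) = d := by
      rw [avPerm_apply, Fin.val_rev]
      omega
    exact_mod_cast this
  rw [projMap_apply, permPoint]
  rw [avDepth_castSucc] at h
  linarith

theorem avoidingPermutohedron_eq_image (d : ℕ) :
    avoidingPermutohedron (d + 1) {pattern123, pattern132} =
      liftMap d 1 '' pitmanStanley d (fun _ => 1) := by
  refine Set.Subset.antisymm (convexHull_min ?_ ?_) ?_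
  · rintro _ ⟨σ, hσ, rfl⟩
    exact ⟨_, projMap_permPoint_mem hσ, liftMap_projMap_permPoint σ⟩
  · exact (convex_pitmanStanley d _).affine_image _
  · rw [pitmanStanley_eq_convexHull, AffineMap.image_convexHull]
    refine convexHull_mono ?_
    rintro _ ⟨_, ⟨S, rfl⟩, rfl⟩
    exact ⟨avPerm S, avPerm_mem S, by
      rw [← projMap_permPoint_avPerm, liftMap_projMap_permPoint]⟩

/-! ### The affine hull -/

lemma affineSpan_pitmanStanley (d : ℕ) :
    affineSpan ℝ (pitmanStanley d (fun _ => 1)) = ⊤ := by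
  -- the open unit cube is contained in the polytope
  have hopen : IsOpen (Set.univ.pi fun _ : Fin d => Set.Ioo (0 : ℝ) 1) :=
    isOpen_set_pi Set.finite_univ fun _ _ => isOpen_Ioo
  have hne : (Set.univ.pi fun _ : Fin d => Set.Ioo (0 : ℝ) 1).Nonempty :=
    ⟨fun _ => 1 / 2, fun _ _ => by norm_num⟩
  refine top_le_iff.1 ((hopen.affineSpan_eq_top hne).symm.le.trans (affineSpan_mono ℝ ?_))
  intro x hx
  refine ⟨fun i => (hx i trivial).1.le, fun j => Finset.sum_le_sum fun i _ => (hx i trivial).2.le⟩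

lemma affineSpan_image_liftMap (d : ℕ) :
    affineSpan ℝ (liftMap d 1 '' pitmanStanley d (fun _ => 1)) =
      (⊤ : AffineSubspace ℝ (Fin d → ℝ)).map (liftMap d 1) := by
  rw [← AffineSubspace.map_span, affineSpan_pitmanStanley]

lemma liftMap_linear (d : ℕ) (m : ℝ) : (liftMap d m).linear = liftLinear d := by
  simp [liftMap]

lemma parallelSpace_image_liftMap (d : ℕ) :
    parallelSpace (liftMap d 1 '' pitmanStanley d (fun _ => 1)) =
      LinearMap.range (liftLinear d) := by
  rw [parallelSpace, affineSpan_image_liftMap, AffineSubspace.map_direction,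
    AffineSubspace.direction_top, Submodule.map_top, liftMap_linear]

lemma mem_integerLattice {n : ℕ} {x : Fin n → ℝ} :
    x ∈ integerLattice n ↔ ∀ i, ∃ z : ℤ, x i = z := Iff.rfl

lemma liftLinear_mem_integerLattice {d : ℕ} {x : Fin d → ℝ} :
    liftLinear d x ∈ integerLattice (d + 1) ↔ x ∈ integerLattice d := by
  constructor
  · intro h i
    simpa using h i.castSucc
  · intro h i
    choose z hz using h
    refine Fin.lastCases ?_ (fun i => ?_) i
    · exact ⟨-∑ i, z i, by simp [hz]⟩
    · exact ⟨z i, by simp [hz]⟩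

lemma liftMap_mem_integerLattice {d : ℕ} (m : ℕ) {x : Fin d → ℝ} :
    liftMap d m x ∈ integerLattice (d + 1) ↔ x ∈ integerLattice d := by
  have h0 : liftMap d m 0 ∈ integerLattice (d + 1) := by
    intro i
    refine Fin.lastCases ?_ (fun i => ?_) i
    · exact ⟨m * (d + 1), by simp⟩
    · exact ⟨m * (d - i), by simp⟩
  rw [liftMap_eq, Submodule.add_mem_iff_left _ h0, liftLinear_mem_integerLattice]

theorem bijOn_projMap (d : ℕ) :
    Set.BijOn (projMap d) (liftMap d 1 '' pitmanStanley d (fun _ => 1))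
      (pitmanStanley d (fun _ => 1)) := by
  refine ⟨?_, ?_, fun x hx => ⟨_, ⟨x, hx, rfl⟩, projMap_liftMap x⟩⟩
  · rintro _ ⟨x, hx, rfl⟩
    rwa [projMap_liftMap]
  · rintro _ ⟨x, -, rfl⟩ _ ⟨y, -, rfl⟩ h
    rw [projMap_liftMap, projMap_liftMap] at h
    rw [h]

theorem bijOn_projMap_integerLattice (d : ℕ) :
    Set.BijOn (projMap d)
      (latticePoints (affineSpan ℝ (liftMap d 1 '' pitmanStanley d (fun _ => 1)) :
        Set (Fin (d + 1) → ℝ))) (integerLattice d : Set (Fin d → ℝ)) := by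
  have hlift : ∀ {x : Fin d → ℝ},
      liftMap d 1 x ∈ integerLattice (d + 1) ↔ x ∈ integerLattice d := by
    intro x
    simpa using liftMap_mem_integerLattice 1 (x := x)
  rw [affineSpan_image_liftMap, latticePoints, AffineSubspace.coe_map, AffineSubspace.top_coe,
    Set.image_univ]
  refine ⟨?_, ?_, fun x hx => ⟨_, ⟨⟨x, rfl⟩, hlift.2 hx⟩, projMap_liftMap x⟩⟩
  · rintro _ ⟨⟨x, rfl⟩, hx⟩
    rw [projMap_liftMap]
    exact hlift.1 hx
  · rintro _ ⟨⟨x, rfl⟩, -⟩ _ ⟨⟨y, rfl⟩, -⟩ h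
    rw [projMap_liftMap, projMap_liftMap] at h
    rw [h]

/-! ### Counting lattice points -/

lemma smul_pitmanStanley {d : ℕ} {m : ℝ} (hm : 0 ≤ m) :
    m • pitmanStanley d (fun _ => 1) = pitmanStanley d (fun _ => m) := by
  rcases hm.eq_or_lt with rfl | hm
  · rw [Set.zero_smul_set ⟨_, psVertex_mem ∅⟩]
    ext x
    rw [mem_pitmanStanley_const, Set.mem_zero]
    constructor
    · rintro rfl
      simp
    · rintro ⟨h1, h2⟩
      funext j
      refine le_antisymm ?_ (h1 j)
      have h3 := Finset.single_le_sum (fun i _ => h1 i) (Finset.mem_Iic.2 (le_refl j))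
      simpa using h3.trans (h2 j)
  · ext x
    rw [Set.mem_smul_set_iff_inv_smul_mem₀ hm.ne', mem_pitmanStanley_const, mem_pitmanStanley_const]
    simp only [Pi.smul_apply, smul_eq_mul, ← Finset.mul_sum, one_mul, inv_mul_le_iff₀ hm]
    simp [hm]

/-- The sequences of `d` natural numbers whose partial sums up to the positions `0, 1, 2, …` are at
most `a, a + m, a + 2m, …`. -/
def boundedSeqs (d a m : ℕ) : Set (Fin d → ℕ) :=
  {x | ∀ j : Fin d, ∑ i ∈ Finset.Iic j, x i ≤ a + m * j}

lemma Fin.sum_Iic_succ {M : Type*} [AddCommMonoid M] {d : ℕ} (x : Fin (d + 1) → M) (j : Fin d) :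
    ∑ i ∈ Finset.Iic j.succ, x i = x 0 + ∑ i ∈ Finset.Iic j, Fin.tail x i := by
  have h : ∀ {n : ℕ} (j : Fin n), Finset.Iic j = Finset.univ.filter (· ≤ j) := by
    intro n j
    ext
    simp
  rw [h, h, Finset.sum_filter, Finset.sum_filter, Fin.sum_univ_succ]
  simp [Fin.succ_le_succ_iff, Fin.tail]

lemma mem_boundedSeqs_succ {d a m : ℕ} {x : Fin (d + 1) → ℕ} :
    x ∈ boundedSeqs (d + 1) a m ↔ x 0 ≤ a ∧ Fin.tail x ∈ boundedSeqs d (a - x 0 + m) m := by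
  have h0 : ∑ i ∈ Finset.Iic (0 : Fin (d + 1)), x i = x 0 := by
    have : Finset.Iic (0 : Fin (d + 1)) = {0} := by
      ext
      simp
    rw [this, Finset.sum_singleton]
  simp only [boundedSeqs, Set.mem_ofPred_eq, Fin.forall_fin_succ, h0, Fin.sum_Iic_succ,
    Fin.val_zero, mul_zero, add_zero, Fin.val_succ, mul_add, mul_one]
  refine and_congr_right fun hx => forall_congr' fun j => ?_
  omega

/-- A bounded sequence consists of its first term and a bounded sequence for the remaining
bounds. -/
def boundedSeqsSuccEquiv (d a m : ℕ) :
    boundedSeqs (d + 1) a m ≃ Σ t : Fin (a + 1), boundedSeqs d (a - t + m) m where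
  toFun x := ⟨⟨x.1 0, Nat.lt_succ_of_le (mem_boundedSeqs_succ.1 x.2).1⟩,
    ⟨Fin.tail x.1, (mem_boundedSeqs_succ.1 x.2).2⟩⟩
  invFun y := ⟨Fin.cons (α := fun _ => ℕ) y.1 y.2.1, mem_boundedSeqs_succ.2
    ⟨Nat.le_of_lt_succ y.1.2, y.2.2⟩⟩
  left_inv x := Subtype.ext (Fin.cons_self_tail x.1)
  right_inv _ := rfl

lemma finite_boundedSeqs (d a m : ℕ) : (boundedSeqs d a m).Finite := by
  refine (Set.finite_Iic fun j : Fin d => a + m * (j : ℕ)).subset fun x hx j => ?_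
  exact (Finset.single_le_sum (fun i _ => Nat.zero_le (x i)) (Finset.mem_Iic.2 (le_refl j))).trans
    (hx j)

lemma card_boundedSeqs_zero (a m : ℕ) : Nat.card (boundedSeqs 0 a m) = 1 := by
  have : boundedSeqs 0 a m = Set.univ := Set.eq_univ_of_forall fun x j => j.elim0
  rw [this]
  simp

lemma card_boundedSeqs_succ (d a m : ℕ) :
    Nat.card (boundedSeqs (d + 1) a m) =
      ∑ s ∈ Finset.range (a + 1), Nat.card (boundedSeqs d (s + m) m) := by
  have : ∀ t : Fin (a + 1), Finite (boundedSeqs d (a - t + m) m) := fun t =>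
    (finite_boundedSeqs d _ m).to_subtype
  rw [Nat.card_congr (boundedSeqsSuccEquiv d a m), Nat.card_sigma,
    Fin.sum_univ_eq_sum_range (fun t => Nat.card (boundedSeqs d (a - t + m) m)) (a + 1),
    ← Finset.sum_range_reflect]
  refine Finset.sum_congr rfl fun s hs => ?_
  have : s < a + 1 := Finset.mem_range.1 hs
  rw [show a - (a + 1 - 1 - s) = s by omega]

/-- The summation formula behind the count: the summand is the difference of consecutive values of
the right-hand side. -/
lemma sum_mul_prod_eq (d m a : ℕ) :
    ∑ s ∈ Finset.range a, ((s : ℚ) + m + 1) / (d + 1).factorial *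
        ∏ i ∈ Finset.range d, ((s : ℚ) + (d + 2) * m + (i + 2)) =
      (a : ℚ) / (d + 2).factorial *
        ∏ i ∈ Finset.range (d + 1), ((a : ℚ) - 1 + (d + 2) * m + (i + 2)) := by
  induction a with
  | zero => simp
  | succ a ih =>
    rw [Finset.sum_range_succ, ih, Finset.prod_range_succ', Finset.prod_range_succ]
    have h1 : ∏ i ∈ Finset.range d, ((a : ℚ) - 1 + (d + 2) * m + (((i + 1 : ℕ) : ℚ) + 2)) =
        ∏ i ∈ Finset.range d, ((a : ℚ) + (d + 2) * m + (i + 2)) := by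
      refine Finset.prod_congr rfl fun i _ => ?_
      push_cast
      ring
    have h2 : ∏ i ∈ Finset.range d, (((a + 1 : ℕ) : ℚ) - 1 + (d + 2) * m + (i + 2)) =
        ∏ i ∈ Finset.range d, ((a : ℚ) + (d + 2) * m + (i + 2)) := by
      refine Finset.prod_congr rfl fun i _ => ?_
      push_cast
      ring
    have hf : ((d + 1).factorial : ℚ) ≠ 0 := by positivity
    rw [h1, h2, Nat.factorial_succ (d + 1)]
    push_cast
    field_simp
    ring

theorem card_boundedSeqs (d a m : ℕ) :
    (Nat.card (boundedSeqs (d + 1) a m) : ℚ) = ((a : ℚ) + 1) / (d + 1).factorial *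
      ∏ i ∈ Finset.range d, ((a : ℚ) + (d + 1) * m + (i + 2)) := by
  induction d generalizing a with
  | zero =>
    rw [card_boundedSeqs_succ]
    simp only [card_boundedSeqs_zero]
    simp
  | succ d ih =>
    rw [card_boundedSeqs_succ, Nat.cast_sum]
    simp only [ih]
    have h := sum_mul_prod_eq d m (a + 1)
    push_cast at h ⊢
    convert h using 1
    · refine Finset.sum_congr rfl fun s _ => ?_
      congr 1
      refine Finset.prod_congr rfl fun i _ => ?_
      ring
    · congr 1
      refine Finset.prod_congr rfl fun i _ => ?_
      ring

lemma latticePoints_pitmanStanley (d m : ℕ) :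
    latticePoints (pitmanStanley d (fun _ => (m : ℝ))) =
      (fun (y : Fin d → ℕ) i => (y i : ℝ)) '' boundedSeqs d m m := by
  have key : ∀ y : Fin d → ℕ, (fun i => (y i : ℝ)) ∈ pitmanStanley d (fun _ => (m : ℝ)) ↔
      y ∈ boundedSeqs d m m := by
    intro y
    rw [mem_pitmanStanley_const]
    refine (and_iff_right fun i => Nat.cast_nonneg _).trans (forall_congr' fun j => ?_)
    rw [mul_add, mul_one, add_comm]
    norm_cast
  ext x
  constructor
  · rintro ⟨hx, hz⟩
    choose z hz using hz
    have hy : x = fun i => ((z i).toNat : ℝ) := by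
      funext i
      have h : (0 : ℝ) ≤ z i := hz i ▸ hx.1 i
      rw [hz i]
      exact_mod_cast (Int.toNat_of_nonneg (by exact_mod_cast h)).symm
    rw [hy] at hx ⊢
    exact ⟨_, (key _).1 hx, rfl⟩
  · rintro ⟨y, hy, rfl⟩
    exact ⟨(key y).2 hy, fun i => ⟨y i, by simp⟩⟩

lemma ncard_latticePoints_pitmanStanley (d m : ℕ) :
    (latticePoints (pitmanStanley d (fun _ => (m : ℝ)))).ncard =
      Nat.card (boundedSeqs d m m) := by
  rw [latticePoints_pitmanStanley, Set.ncard_image_of_injective, Nat.card_coe_set_eq]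
  intro x y h
  funext i
  exact Nat.cast_injective (congrFun h i)

lemma liftMap_injective (d : ℕ) (m : ℝ) : Function.Injective (liftMap d m) := by
  intro x y h
  funext i
  simpa using congrFun h i.castSucc

lemma latticePoints_smul_image_liftMap (d m : ℕ) :
    latticePoints ((m : ℝ) • (liftMap d 1 '' pitmanStanley d (fun _ => 1))) =
      liftMap d m '' latticePoints (pitmanStanley d (fun _ => (m : ℝ))) := by
  have h : (m : ℝ) • (liftMap d 1 '' pitmanStanley d (fun _ => 1)) =
      liftMap d m '' pitmanStanley d (fun _ => (m : ℝ)) := by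
    rw [← smul_pitmanStanley m.cast_nonneg, ← Set.image_smul, ← Set.image_smul, Set.image_image,
      Set.image_image]
    simp only [smul_liftMap]
  rw [h]
  ext x
  constructor
  · rintro ⟨⟨y, hy, rfl⟩, hx⟩
    exact ⟨y, ⟨hy, (liftMap_mem_integerLattice m).1 hx⟩, rfl⟩
  · rintro ⟨y, ⟨hy, hx⟩, rfl⟩
    exact ⟨⟨y, hy, rfl⟩, (liftMap_mem_integerLattice m).2 hx⟩

lemma ncard_latticePoints_smul (d m : ℕ) :
    (latticePoints ((m : ℝ) • (liftMap d 1 '' pitmanStanley d (fun _ => 1)))).ncard =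
      Nat.card (boundedSeqs d m m) := by
  rw [latticePoints_smul_image_liftMap, Set.ncard_image_of_injective _ (liftMap_injective d m),
    ncard_latticePoints_pitmanStanley]

lemma finite_latticePoints_smul (d m : ℕ) :
    (latticePoints ((m : ℝ) • (liftMap d 1 '' pitmanStanley d (fun _ => 1)))).Finite := by
  rw [latticePoints_smul_image_liftMap, latticePoints_pitmanStanley]
  exact ((finite_boundedSeqs d m m).image _).image _

theorem isEhrhartPolynomial_image_liftMap (d : ℕ) :
    IsEhrhartPolynomial (liftMap (d + 1) 1 '' pitmanStanley (d + 1) (fun _ => 1))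
      (Polynomial.C (1 / ((d + 1).factorial : ℚ)) * (Polynomial.X + 1) *
        ∏ j ∈ Finset.Icc 2 (d + 1),
          (Polynomial.C ((d + 2 : ℕ) : ℚ) * Polynomial.X + Polynomial.C (j : ℚ))) := by
  refine fun m => ⟨finite_latticePoints_smul (d + 1) m, ?_⟩
  rw [ncard_latticePoints_smul, card_boundedSeqs]
  simp only [Polynomial.eval_mul, Polynomial.eval_C, Polynomial.eval_add, Polynomial.eval_X,
    Polynomial.eval_one, Polynomial.eval_prod]
  have : Finset.Icc 2 (d + 1) = Finset.Ico 2 (d + 2) := by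
    ext
    simp
    omega
  rw [this, Finset.prod_Ico_eq_prod_range]
  simp only [Nat.add_sub_cancel]
  rw [one_div_mul_eq_div]
  congr 1
  refine Finset.prod_congr rfl fun i _ => ?_
  push_cast
  ring

theorem card_boundedSeqs_one_one (d : ℕ) :
    (Nat.card (boundedSeqs d 1 1) : ℚ) =
      1 / (((d + 1 : ℕ) : ℚ) + 1) * ((2 * (d + 1)).choose (d + 1) : ℚ) := by
  cases d with
  | zero =>
    rw [card_boundedSeqs_zero]
    norm_num
  | succ k =>
    rw [card_boundedSeqs]
    have hG : ∏ i ∈ Finset.range k, (((1 : ℕ) : ℚ) + ((k : ℚ) + 1) * (1 : ℕ) + (i + 2)) =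
        (((k + 3 + 1).ascFactorial k : ℕ) : ℚ) := by
      rw [Nat.ascFactorial_eq_prod_range, Nat.cast_prod]
      refine Finset.prod_congr rfl fun i _ => ?_
      push_cast
      ring
    have h1 : (((k + 3).factorial : ℕ) : ℚ) * ((k + 3 + 1).ascFactorial k : ℕ) =
        ((k + 3 + k).factorial : ℕ) := by
      exact_mod_cast Nat.factorial_mul_ascFactorial (k + 3) k
    have h2 : (((2 * (k + 2)).choose (k + 2) : ℕ) : ℚ) * ((k + 2).factorial : ℕ) *
        ((k + 2).factorial : ℕ) = ((2 * (k + 2)).factorial : ℕ) := by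
      have := Nat.choose_mul_factorial_mul_factorial (show k + 2 ≤ 2 * (k + 2) by omega)
      rw [show 2 * (k + 2) - (k + 2) = k + 2 by omega] at this
      exact_mod_cast this
    have h3 : ((2 * (k + 2)).factorial : ℚ) = (2 * ((k : ℚ) + 2)) * (k + 3 + k).factorial := by
      rw [show 2 * (k + 2) = (k + 3 + k) + 1 by ring, Nat.factorial_succ]
      push_cast
      ring
    have h4 : ((k + 2).factorial : ℚ) = ((k : ℚ) + 2) * (k + 1).factorial := by
      rw [Nat.factorial_succ (k + 1)]
      push_cast
      ring
    have h5 : ((k + 3).factorial : ℚ) = ((k : ℚ) + 3) * (((k : ℚ) + 2) * (k + 1).factorial) := by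
      rw [Nat.factorial_succ (k + 2), ← h4]
      push_cast
      ring
    rw [h3, ← h1, h4, h5] at h2
    have hf : ((k + 1).factorial : ℚ) ≠ 0 := by positivity
    have hk : (k : ℚ) + 2 ≠ 0 := by positivity
    have hk3 : (k : ℚ) + 3 ≠ 0 := by positivity
    have hc : ((2 * (k + 2)).choose (k + 2) : ℚ) =
        2 * ((k : ℚ) + 3) * ((k + 3 + 1).ascFactorial k : ℕ) / (k + 1).factorial := by
      rw [eq_div_iff hf]
      have hne : ((k : ℚ) + 2) * (((k : ℚ) + 2) * (k + 1).factorial) ≠ 0 := by positivity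
      refine mul_right_cancel₀ hne ?_
      linear_combination h2
    rw [hG, show k + 1 + 1 = k + 2 from rfl, hc]
    push_cast
    rw [show (k : ℚ) + 2 + 1 = k + 3 by ring]
    field_simp
    ring

/-! ### Volume -/

lemma integerLattice_eq_span (d : ℕ) :
    integerLattice d = Submodule.span ℤ (Set.range (Pi.basisFun ℝ (Fin d))) := by
  ext x
  rw [Module.Basis.mem_span_iff_repr_mem, mem_integerLattice]
  refine forall_congr' fun i => ?_
  simp [eq_comm]

instance (d : ℕ) : DiscreteTopology (integerLattice d) := by
  rw [integerLattice_eq_span]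
  infer_instance

instance (d : ℕ) : IsZLattice ℝ (integerLattice d) := by
  have h : IsZLattice ℝ (Submodule.span ℤ (Set.range (Pi.basisFun ℝ (Fin d)))) := inferInstance
  exact ⟨by rw [integerLattice_eq_span]; exact h.span_top⟩

/-- The covolume of `ℤ^d` is the measure of the unit cube. -/
lemma covolume_integerLattice (d : ℕ) (ν : MeasureTheory.Measure (Fin d → ℝ))
    [ν.IsAddHaarMeasure] :
    ZLattice.covolume (integerLattice d) ν =
      ν.real (ZSpan.fundamentalDomain (Pi.basisFun ℝ (Fin d))) := by
  refine ZLattice.covolume_eq_measure_fundamentalDomain _ _ ?_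
  rw [integerLattice_eq_span]
  exact ZSpan.isAddFundamentalDomain _ ν

/-- The ratio of the measures of a set and of the unit cube is the Lebesgue measure of the set. -/
lemma real_div_covolume_integerLattice (d : ℕ) (ν : MeasureTheory.Measure (Fin d → ℝ))
    [ν.IsAddHaarMeasure] (s : Set (Fin d → ℝ)) :
    ν.real s / ZLattice.covolume (integerLattice d) ν = MeasureTheory.volume.real s := by
  have h0 := ZLattice.covolume_ne_zero (integerLattice d) ν
  rw [covolume_integerLattice] at h0 ⊢
  rw [MeasureTheory.Measure.isAddLeftInvariant_eq_smul ν MeasureTheory.volume] at h0 ⊢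
  rw [MeasureTheory.measureReal_nnreal_smul_apply, MeasureTheory.measureReal_nnreal_smul_apply,
    ZSpan.fundamentalDomain_pi_basisFun, MeasureTheory.measureReal_def,
    MeasureTheory.measureReal_def, Real.volume_pi_Ico] at *
  simp only [sub_zero, ENNReal.ofReal_one, Finset.prod_const_one, ENNReal.toReal_one, mul_one] at *
  exact mul_div_cancel_left₀ _ h0

/-- In the coordinates of a lattice basis of the parallel space, the relative volume of `P` is the
Lebesgue measure of `P`. -/
lemma relativeVolume_eq {n d : ℕ} {P : Set (Fin n → ℝ)} (h : P.Nonempty)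
    (e : (Fin d → ℝ) ≃L[ℝ] parallelSpace P)
    (he : ∀ x, (e x : Fin n → ℝ) ∈ integerLattice n ↔ x ∈ integerLattice d) :
    relativeVolume P = MeasureTheory.volume.real {x | h.some + (e x : Fin n → ℝ) ∈ P} := by
  set μ : MeasureTheory.Measure (parallelSpace P) := MeasureTheory.Measure.addHaar
  let e' : parallelSpace P ≃ᵐ (Fin d → ℝ) := e.symm.toHomeomorph.toMeasurableEquiv
  let ν : MeasureTheory.Measure (Fin d → ℝ) := μ.map e'
  have hν : ν.IsAddHaarMeasure := e.symm.isAddHaarMeasure_map μ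
  have hL : parallelLattice P = ZLattice.comap ℝ (integerLattice d) e.symm.toLinearMap := by
    ext v
    have := he (e.symm v)
    rw [e.apply_symm_apply] at this
    exact this
  have hpres : MeasureTheory.MeasurePreserving e.symm μ ν := ⟨e'.measurable, rfl⟩
  rw [relativeVolume, dif_pos h, hL, ZLattice.covolume_comap (integerLattice d) ν μ hpres,
    ← real_div_covolume_integerLattice d ν]
  congr 1
  rw [MeasureTheory.measureReal_def, MeasureTheory.measureReal_def, e'.map_apply]
  congr 2
  ext v
  change _ ↔ h.some + (e (e.symm v) : Fin n → ℝ) ∈ P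
  rw [e.apply_symm_apply]
  rfl

lemma liftLinear_injective (d : ℕ) : Function.Injective (liftLinear d) := by
  intro x y h
  funext i
  simpa using congrFun h i.castSucc

/-- The parallel space of the permutohedron, coordinatized by the first `d` coordinates. -/
noncomputable def parallelEquiv (d : ℕ) :
    (Fin d → ℝ) ≃L[ℝ] parallelSpace (liftMap d 1 '' pitmanStanley d (fun _ => 1)) :=
  ((LinearEquiv.ofInjective (liftLinear d) (liftLinear_injective d)).trans
    (LinearEquiv.ofEq _ _ (parallelSpace_image_liftMap d).symm)).toContinuousLinearEquiv

lemma coe_parallelEquiv (d : ℕ) (x : Fin d → ℝ) :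
    (parallelEquiv d x : Fin (d + 1) → ℝ) = liftLinear d x := rfl

lemma relativeVolume_image_liftMap (d : ℕ) :
    relativeVolume (liftMap d 1 '' pitmanStanley d (fun _ => 1)) =
      MeasureTheory.volume.real (pitmanStanley d (fun _ => 1)) := by
  have hne : (liftMap d 1 '' pitmanStanley d (fun _ => 1)).Nonempty :=
    ⟨_, _, psVertex_mem ∅, rfl⟩
  rw [relativeVolume_eq hne (parallelEquiv d) fun x => by
    rw [coe_parallelEquiv, liftLinear_mem_integerLattice]]
  obtain ⟨p, -, hp⟩ := hne.some_mem
  have hset : {x | hne.some + (parallelEquiv d x : Fin (d + 1) → ℝ) ∈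
      liftMap d 1 '' pitmanStanley d (fun _ => 1)} =
      (fun x => p + x) ⁻¹' pitmanStanley d (fun _ => 1) := by
    ext x
    have : hne.some + liftLinear d x = liftMap d 1 (p + x) := by
      rw [← hp, liftMap_eq 1 p, liftMap_eq 1 (p + x), map_add]
      abel
    change hne.some + liftLinear d x ∈ liftMap d 1 '' pitmanStanley d (fun _ => 1) ↔
      p + x ∈ pitmanStanley d (fun _ => 1)
    rw [this, (liftMap_injective d 1).mem_set_image]
  rw [hset, MeasureTheory.measureReal_def, MeasureTheory.measure_preimage_add]
  rfl

lemma isBounded_pitmanStanley (d : ℕ) :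
    Bornology.IsBounded (pitmanStanley d (fun _ => 1)) := by
  refine (Metric.isBounded_Icc (0 : Fin d → ℝ) (fun j => (j : ℝ) + 1)).subset fun x hx => ?_
  rw [mem_pitmanStanley_const] at hx
  refine ⟨hx.1, fun j => ?_⟩
  have h := Finset.single_le_sum (fun i _ => hx.1 i) (Finset.mem_Iic.2 (le_refl j))
  simpa using h.trans (hx.2 j)

lemma isClosed_pitmanStanley (d : ℕ) (c : Fin d → ℝ) : IsClosed (pitmanStanley d c) := by
  have : pitmanStanley d c = (⋂ i, {x | 0 ≤ x i}) ∩
      ⋂ j, {x | ∑ i ∈ Finset.Iic j, x i ≤ ∑ i ∈ Finset.Iic j, c i} := by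
    ext x
    simp [pitmanStanley]
  rw [this]
  exact (isClosed_iInter fun i => isClosed_le continuous_const (by fun_prop)).inter
    (isClosed_iInter fun j => isClosed_le (by fun_prop) continuous_const)

/-- The volume is the limit of the numbers of lattice points in dilates, suitably scaled. -/
lemma tendsto_card_boundedSeqs (d : ℕ) :
    Filter.Tendsto (fun m : ℕ => (Nat.card (boundedSeqs d m m) : ℝ) / (m : ℝ) ^ d) Filter.atTop
      (nhds (MeasureTheory.volume.real (pitmanStanley d (fun _ => 1)))) := by
  have h := tendsto_card_div_pow_atTop_volume (pitmanStanley d (fun _ => 1))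
    (isBounded_pitmanStanley d) (isClosed_pitmanStanley d _).measurableSet
    ((convex_pitmanStanley d _).addHaar_frontier _)
  rw [Fintype.card_fin, ← integerLattice_eq_span] at h
  refine h.congr' ?_
  filter_upwards [Filter.eventually_gt_atTop 0] with m hm
  have hm : (m : ℝ) ≠ 0 := by exact_mod_cast hm.ne'
  congr 2
  rw [← ncard_latticePoints_pitmanStanley, ← smul_pitmanStanley m.cast_nonneg,
    ← Nat.card_coe_set_eq]
  refine Nat.card_congr (Equiv.subtypeEquiv (Equiv.smulRight hm) fun x => ?_)
  simp_rw [latticePoints, Set.mem_inter_iff, Equiv.smulRight_apply, Set.smul_mem_smul_set_iff₀ hm,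
    ← Set.mem_inv_smul_set_iff₀ hm]

lemma tendsto_linear_div (a b : ℝ) :
    Filter.Tendsto (fun m : ℕ => (a * m + b) / (m : ℝ)) Filter.atTop (nhds a) := by
  have h : Filter.Tendsto (fun m : ℕ => a + b / (m : ℝ)) Filter.atTop (nhds (a + 0)) :=
    tendsto_const_nhds.add (tendsto_const_div_atTop_nhds_zero_nat b)
  rw [add_zero] at h
  refine h.congr' ?_
  filter_upwards [Filter.eventually_gt_atTop 0] with m hm
  have hm : (m : ℝ) ≠ 0 := by exact_mod_cast hm.ne'
  field_simp

theorem volume_pitmanStanley (d : ℕ) :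
    (d.factorial : ℝ) * MeasureTheory.volume.real (pitmanStanley d (fun _ => 1)) =
      ((d + 1 : ℕ) : ℝ) ^ (((d + 1 : ℕ) : ℤ) - 2) := by
  have h := tendsto_card_boundedSeqs d
  cases d with
  | zero =>
    simp only [card_boundedSeqs_zero, pow_zero, Nat.cast_one, div_one] at h
    rw [← tendsto_nhds_unique tendsto_const_nhds h]
    norm_num
  | succ k =>
    have h2 : Filter.Tendsto (fun m : ℕ => ((k + 1).factorial : ℝ)⁻¹ *
        (((1 : ℝ) * m + 1) / (m : ℝ) *
          ∏ i ∈ Finset.range k, (((k : ℝ) + 2) * m + (i + 2)) / (m : ℝ))) Filter.atTop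
        (nhds (((k + 1).factorial : ℝ)⁻¹ * (1 * ∏ _i ∈ Finset.range k, ((k : ℝ) + 2)))) :=
      ((tendsto_linear_div 1 1).mul
        (tendsto_finsetProd _ fun i _ => tendsto_linear_div _ _)).const_mul _
    have h3 := tendsto_nhds_unique h (h2.congr fun m => ?_)
    · rw [h3, Finset.prod_const, Finset.card_range, one_mul, mul_inv_cancel_left₀ (by positivity)]
      rw [show (((k + 1 + 1 : ℕ) : ℤ) - 2) = (k : ℤ) by push_cast; ring, zpow_natCast]
      push_cast
      ring
    · have hc : (Nat.card (boundedSeqs (k + 1) m m) : ℝ) = ((m : ℝ) + 1) / (k + 1).factorial *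
          ∏ i ∈ Finset.range k, ((m : ℝ) + (k + 1) * m + (i + 2)) := by
        have hq := congrArg (Rat.cast : ℚ → ℝ) (card_boundedSeqs k m m)
        push_cast at hq
        exact hq
      rw [hc, Finset.prod_div_distrib, Finset.prod_const, Finset.card_range, pow_succ', one_mul]
      have : ∏ i ∈ Finset.range k, ((m : ℝ) + (k + 1) * m + (i + 2)) =
          ∏ i ∈ Finset.range k, (((k : ℝ) + 2) * m + (i + 2)) :=
        Finset.prod_congr rfl fun i _ => by ring
      rw [this]
      simp only [div_eq_mul_inv, mul_inv]
      ring

theorem normalizedVolume_image_liftMap (d : ℕ) :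
    normalizedVolume (liftMap d 1 '' pitmanStanley d (fun _ => 1)) =
      ((d + 1 : ℕ) : ℝ) ^ (((d + 1 : ℕ) : ℤ) - 2) := by
  have h : Module.finrank ℝ (parallelSpace (liftMap d 1 '' pitmanStanley d (fun _ => 1))) = d := by
    rw [← (parallelEquiv d).toLinearEquiv.finrank_eq, Module.finrank_fin_fun]
  rw [normalizedVolume, h, relativeVolume_image_liftMap, volume_pitmanStanley]

/-! ### The permutohedron -/

theorem mainTheorem6 (n : ℕ) (hn : 1 ≤ n) (P : Set (Fin n → ℝ))
    (hP : P = avoidingPermutohedron n {pattern123, pattern132}) :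
    CombinatoriallyEquivalent P (unitCube (n - 1)) ∧
    (2 ≤ n → IsEhrhartPolynomial P
      (Polynomial.C (1 / ((n - 1).factorial : ℚ)) * (Polynomial.X + 1) *
        ∏ j ∈ Finset.Icc 2 (n - 1), (Polynomial.C (n : ℚ) * Polynomial.X + Polynomial.C (j : ℚ)))) ∧
    (Set.BijOn (projShift n) P (pitmanStanley (n - 1) (fun _ => 1)) ∧
      Set.BijOn (projShift n) (latticePoints (affineSpan ℝ P : Set (Fin n → ℝ)))
        (integerLattice (n - 1) : Set (Fin (n - 1) → ℝ))) ∧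
    normalizedVolume P = (n : ℝ) ^ ((n : ℤ) - 2) ∧
    ((latticePoints P).ncard : ℚ) = 1 / ((n : ℚ) + 1) * ((2 * n).choose n : ℚ) := by
  obtain ⟨d, rfl⟩ := Nat.exists_eq_add_of_le' hn
  rw [avoidingPermutohedron_eq_image] at hP
  subst hP
  simp only [Nat.add_sub_cancel]
  refine ⟨?_, ?_, ⟨?_, ?_⟩, normalizedVolume_image_liftMap d, ?_⟩
  · obtain ⟨e⟩ := ((isCubical_pitmanStanley d).image (liftMap d 1) (projMap d)
      projMap_liftMap).nonempty_orderIso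
    obtain ⟨e'⟩ := (isCubical_unitCube d).nonempty_orderIso
    exact ⟨e.trans e'.symm⟩
  · intro h2
    obtain ⟨k, rfl⟩ := Nat.exists_eq_add_of_le' (Nat.le_of_succ_le_succ h2)
    exact isEhrhartPolynomial_image_liftMap k
  · rw [projShift_succ]
    exact bijOn_projMap d
  · rw [projShift_succ]
    exact bijOn_projMap_integerLattice d
  · have h := ncard_latticePoints_smul d 1
    rw [Nat.cast_one, one_smul] at h
    rw [h, card_boundedSeqs_one_one]
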